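/- For an integer $n>2$ and real $x>0$ let $$f_n(x)=\left(\frac{\sqrt{x}}{1+x}\right)^{n-2}\frac{1-x}{1+x},\qquad F_n(x)=\sum_{k=1}^{\infty} f_n(2^k x),$$ where the series converges for every $x>0$. Then there is a power series $S_n(x)=\sum_{m\ge 0}a_m x^m$ with real coefficients (depending only on $n$), converging for $x\in[0,1)$, and satisfying $S_n(0)=0$ if $n\neq 3$, such that for all $x\in(0,1)$ $$F_n(x)=\begin{cases}\displaystyle S_n(x)-\frac{4\pi}{\ln 2}\sum_{k=1}^{\infty}c_k\,\frac{\sin(2k\pi\log_2 x)}{\sinh(2k\pi^2/\ln 2)} & \text{if } n=2l \text{ is even } (l\ge 2),\\[3mm] \displaystyle \sqrt{x}\,S_n(x)-\frac{4\pi}{\ln 2}\sum_{k=1}^{\infty}b_k\,\frac{\sin(2k\pi\log_2 x)}{\cosh(2k\pi^2/\ln 2)} & \text{if } n=2l+1 \text{ is odd } (l\ge 1),\end{cases}$$ where the series over $k$ converge and $$c_k=\frac{1}{(2l-2)!}\prod_{j=0}^{l-2}\left(j^2+\frac{4\pi^2k^2}{(\ln 2)^2}\right)\quad(n=2l),\qquad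 b_k=\frac{2\pi k}{(\ln 2)\,(2l-1)!}\prod_{j=0}^{l-2}\left(\Big(j+\tfrac12\Big)^2+\frac{4\pi^2k^2}{(\ln 2)^2}\right)\quad(n=2l+1),$$ an empty product being $1$. -/

import Mathlib

namespace AlmostIdentity

/-- `f_n(x) = (√x / (1 + x)) ^ (n - 2) * (1 - x) / (1 + x)`, used for `n > 2` and `x > 0`. -/
noncomputable def f (n : ℕ) (x : ℝ) : ℝ :=
  (Real.sqrt x / (1 + x)) ^ (n - 2) * ((1 - x) / (1 + x))

/-- `F_n(x) = ∑_{k ≥ 1} f_n(2 ^ k * x)`; the summation index is `k + 1` with `k : ℕ`. -/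
noncomputable def F (n : ℕ) (x : ℝ) : ℝ :=
  ∑' k : ℕ, f n (2 ^ (k + 1) * x)

/-- The coefficient `c_k` for `n = 2 * l`, `l > 1`; the index `j` runs over `0, …, l - 2`. -/
noncomputable def c (l k : ℕ) : ℝ :=
  (∏ j ∈ Finset.range (l - 1),
      ((j : ℝ) ^ 2 + 4 * Real.pi ^ 2 * (k : ℝ) ^ 2 / Real.log 2 ^ 2)) /
    (Nat.factorial (2 * l - 2) : ℝ)

/-- The coefficient `b_k` for `n = 2 * l + 1`, `l ≥ 1`; the index `j` runs over `0, …, l - 2`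
(an empty product if `l = 1`). -/
noncomputable def b (l k : ℕ) : ℝ :=
  (2 * Real.pi * (k : ℝ) *
      ∏ j ∈ Finset.range (l - 1),
        (((j : ℝ) + 1 / 2) ^ 2 + 4 * Real.pi ^ 2 * (k : ℝ) ^ 2 / Real.log 2 ^ 2)) /
    (Real.log 2 * (Nat.factorial (2 * l - 1) : ℝ))

/-- The `k`-th term of the sine series for `n = 2 * l`. -/
noncomputable def evenTerm (l k : ℕ) (x : ℝ) : ℝ :=
  c l k * (Real.sin (2 * (k : ℝ) * Real.pi * Real.logb 2 x) /
    Real.sinh (2 * (k : ℝ) * Real.pi ^ 2 / Real.log 2))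

/-- The `k`-th term of the sine series for `n = 2 * l + 1`. -/
noncomputable def oddTerm (l k : ℕ) (x : ℝ) : ℝ :=
  b l k * (Real.sin (2 * (k : ℝ) * Real.pi * Real.logb 2 x) /
    Real.cosh (2 * (k : ℝ) * Real.pi ^ 2 / Real.log 2))

end AlmostIdentity

namespace AlmostIdentity

/-! Completing `F n x` with the terms `f n (x / 2 ^ k)`, `k ≥ 0`, gives a sum over all of `ℤ`,
invariant under `x ↦ 2x`. Put `s = n - 2`. In the variable `t = logb 2 x`, Poisson summation
(`tsum_two_sided_eq`) turns this sum into a Fourier series. Its coefficients are Beta integrals,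
hence products `Γ(s/2 - iω) Γ(s/2 + iω)` with `ω = 2πk / log 2`. The recurrence and reflection
formulas for `Γ` reduce these to a finite product over `sinh (πω)` for `s` even, or over `cosh (πω)`
for `s` odd. The added half is elementary: for `0 < x < 1`, expand `f` in its Taylor series and sum
over `k` geometrically (`tsum_f_half_pow_mul`). The result is `√x ^ s` times a power series, and
moving it to the other side yields `S_n`. -/

/-! ### Fourier transform of `v ↦ f n (exp v)` via Beta and Gamma functions -/

theorem intervalIntegral_eq_integral_sigmoid (g : ℝ → ℂ) :
    ∫ x in (0 : ℝ)..1, g x =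
      ∫ v : ℝ, ((Real.sigmoid v * (1 - Real.sigmoid v) : ℝ) : ℂ) * g (Real.sigmoid v) := by
  have h := MeasureTheory.integral_image_eq_integral_abs_deriv_smul (s := Set.univ)
    (f := Real.sigmoid) (f' := fun v => Real.sigmoid v * (1 - Real.sigmoid v)) MeasurableSet.univ
    (fun v _ => (Real.hasDerivAt_sigmoid v).hasDerivWithinAt)
    Real.sigmoid_injective.injOn g
  rw [Set.image_univ, Real.range_sigmoid, MeasureTheory.Measure.restrict_univ] at h
  rw [intervalIntegral.integral_of_le zero_le_one, MeasureTheory.integral_Ioc_eq_integral_Ioo, h]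
  refine MeasureTheory.integral_congr_ae (.of_forall fun v => ?_)
  have h0 : 0 ≤ Real.sigmoid v * (1 - Real.sigmoid v) :=
    mul_nonneg (Real.sigmoid_nonneg v) (by linarith [Real.sigmoid_le_one v])
  simp only [abs_of_nonneg h0, Complex.real_smul]

theorem sigmoid_eq_exp (v : ℝ) :
    Real.sigmoid v = Real.exp (v - Real.log (1 + Real.exp v)) := by
  have h : 0 < 1 + Real.exp v := by positivity
  rw [Real.exp_sub, Real.exp_log h, Real.sigmoid_def, Real.exp_neg]
  field_simp
  ring

theorem one_sub_sigmoid_eq_exp (v : ℝ) :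
    1 - Real.sigmoid v = Real.exp (-Real.log (1 + Real.exp v)) := by
  have h : 0 < 1 + Real.exp v := by positivity
  rw [sigmoid_eq_exp, Real.exp_neg, Real.exp_sub, Real.exp_log h]
  field_simp
  ring

theorem ofReal_exp_cpow (y : ℝ) (a : ℂ) : ((Real.exp y : ℝ) : ℂ) ^ a = Complex.exp (y * a) := by
  rw [Complex.cpow_def_of_ne_zero (by exact_mod_cast (Real.exp_pos y).ne'),
    ← Complex.ofReal_log (Real.exp_pos y).le, Real.log_exp]

theorem f_exp (s : ℕ) (v : ℝ) :
    f (s + 2) (Real.exp v) =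
      Real.exp (s * (v / 2 - Real.log (1 + Real.exp v))) *
        (Real.exp (-Real.log (1 + Real.exp v)) - Real.exp (v - Real.log (1 + Real.exp v))) := by
  have h : 0 < 1 + Real.exp v := by positivity
  rw [f, Nat.add_sub_cancel, Real.exp_nat_mul, Real.exp_sub, Real.exp_sub, Real.exp_neg,
    Real.exp_log h, Real.sqrt_eq_iff_mul_self_eq (Real.exp_pos v).le (Real.exp_pos (v/2)).le |>.2
      (by rw [← Real.exp_add]; ring_nf)]
  ring

/-- With `σ = sigmoid v` one has `f (s + 2) (exp v) = (σ (1 - σ)) ^ (s / 2) * ((1 - σ) - σ)`. Since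
`dσ = σ (1 - σ) dv`, the integral is a difference of two Beta integrals. -/
theorem integral_exp_mul_f_exp {s : ℕ} (hs : 0 < s) (ω : ℝ) :
    ∫ v : ℝ, Complex.exp (-(Complex.I * ω * v)) * (f (s + 2) (Real.exp v) : ℂ) =
      2 * Complex.I * ω * (Complex.Gamma (s / 2 - Complex.I * ω) *
        Complex.Gamma (s / 2 + Complex.I * ω)) / (s.factorial : ℂ) := by
  set a : ℂ := s / 2 - Complex.I * ω with ha
  set b : ℂ := s / 2 + Complex.I * ω with hb
  have hs' : (0 : ℝ) < s := by exact_mod_cast hs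
  have har : 0 < a.re := by simp [ha, hs]
  have hbr : 0 < b.re := by simp [hb, hs]
  have har1 : 0 < (a + 1).re := by simp; linarith
  have hbr1 : 0 < (b + 1).re := by simp; linarith
  have hab : a + b = s := by rw [ha, hb]; ring
  have ha0 : a ≠ 0 := fun h => by simp [h] at har
  have hb0 : b ≠ 0 := fun h => by simp [h] at hbr
  have hfac : Complex.Gamma (s + 1) = s.factorial := Complex.Gamma_nat_eq_factorial s
  have hf0 : (s.factorial : ℂ) ≠ 0 := by exact_mod_cast s.factorial_ne_zero
  have h1 := Complex.Gamma_mul_Gamma_eq_betaIntegral har hbr1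
  have h2 := Complex.Gamma_mul_Gamma_eq_betaIntegral har1 hbr
  rw [← add_assoc, hab, hfac, Complex.Gamma_add_one _ hb0] at h1
  rw [add_right_comm, hab, hfac, Complex.Gamma_add_one _ ha0] at h2
  have h3 : ∫ v : ℝ, Complex.exp (-(Complex.I * ω * v)) * (f (s + 2) (Real.exp v) : ℂ) =
      Complex.betaIntegral a (b + 1) - Complex.betaIntegral (a + 1) b := by
    rw [Complex.betaIntegral, Complex.betaIntegral, ← intervalIntegral.integral_sub
      (Complex.betaIntegral_convergent har hbr1) (Complex.betaIntegral_convergent har1 hbr),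
      intervalIntegral_eq_integral_sigmoid]
    refine MeasureTheory.integral_congr_ae (.of_forall fun v => ?_)
    have e1 : (1 : ℂ) - (Real.sigmoid v : ℂ) =
        (Real.exp (-Real.log (1 + Real.exp v)) : ℝ) := by
      rw [← one_sub_sigmoid_eq_exp]; push_cast; ring
    simp only [e1, f_exp]
    rw [one_sub_sigmoid_eq_exp, sigmoid_eq_exp, ← Real.exp_add]
    simp only [ofReal_exp_cpow]
    push_cast
    simp only [mul_sub, ← Complex.exp_add]
    rw [ha, hb]
    congr 2 <;> ring
  rw [h3, eq_div_iff hf0]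
  have : b - a = 2 * Complex.I * ω := by rw [ha, hb]; ring
  rw [← this]
  -- Both Beta values are multiples of `Γ(a) Γ(b) / s!`, by `b` and by `a`; the difference leaves
  -- the factor `b - a = 2iω`.
  linear_combination h2 - h1

/-- The recurrence `Γ(z + 1) = z Γ(z)` at conjugate points contributes `(j + a) ^ 2 + ω ^ 2` at each
step. The cases used are `a = 0` (even `n`) and `a = 1 / 2` (odd `n`). -/
theorem Gamma_add_nat_mul_Gamma_add_nat (a ω : ℝ) (hω : ω ≠ 0) (p : ℕ) :
    Complex.Gamma (a + p - Complex.I * ω) * Complex.Gamma (a + p + Complex.I * ω) =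
      ((∏ j ∈ Finset.range p, ((j + a) ^ 2 + ω ^ 2) : ℝ) : ℂ) *
        (Complex.Gamma (a - Complex.I * ω) * Complex.Gamma (a + Complex.I * ω)) := by
  induction p with
  | zero => simp
  | succ p ih =>
    have h1 : (a + p - Complex.I * ω : ℂ) ≠ 0 := fun h => hω (by simpa using congrArg Complex.im h)
    have h2 : (a + p + Complex.I * ω : ℂ) ≠ 0 := fun h => hω (by simpa using congrArg Complex.im h)
    have e1 : (a + (p + 1 : ℕ) - Complex.I * ω : ℂ) = a + p - Complex.I * ω + 1 := by
      push_cast; ring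
    have e2 : (a + (p + 1 : ℕ) + Complex.I * ω : ℂ) = a + p + Complex.I * ω + 1 := by
      push_cast; ring
    rw [e1, e2, Complex.Gamma_add_one _ h1, Complex.Gamma_add_one _ h2, Finset.prod_range_succ]
    push_cast at ih ⊢
    linear_combination (((p + a : ℂ)) ^ 2 + ω ^ 2) * ih -
      Complex.I_sq * ω ^ 2 * Complex.Gamma (a + p - Complex.I * ω) *
        Complex.Gamma (a + p + Complex.I * ω)

theorem Gamma_neg_I_mul_mul_Gamma_I_mul {ω : ℝ} (hω : ω ≠ 0) :
    Complex.Gamma (-(Complex.I * ω)) * Complex.Gamma (Complex.I * ω) =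
      ((Real.pi / (ω * Real.sinh (Real.pi * ω)) : ℝ) : ℂ) := by
  have hω' : (ω : ℂ) ≠ 0 := by exact_mod_cast hω
  have h0 : -(Complex.I * ω) ≠ 0 := neg_ne_zero.2 (mul_ne_zero Complex.I_ne_zero hω')
  have hsh : Complex.sinh (Real.pi * ω) ≠ 0 := by
    rw [← Complex.ofReal_mul, ← Complex.ofReal_sinh]
    exact_mod_cast Real.sinh_ne_zero.2 (mul_ne_zero Real.pi_ne_zero hω)
  have h := Complex.Gamma_mul_Gamma_one_sub (Complex.I * ω)
  rw [show (1 : ℂ) - Complex.I * ω = -(Complex.I * ω) + 1 by ring, Complex.Gamma_add_one _ h0,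
    show (Real.pi * (Complex.I * ω) : ℂ) = Real.pi * ω * Complex.I by ring,
    Complex.sin_mul_I, eq_div_iff (mul_ne_zero hsh Complex.I_ne_zero)] at h
  push_cast
  rw [eq_div_iff (mul_ne_zero hω' hsh)]
  linear_combination h + Complex.Gamma (-(Complex.I * ω)) * Complex.Gamma (Complex.I * ω) * ω *
    Complex.sinh (Real.pi * ω) * Complex.I_sq

theorem Gamma_half_sub_mul_Gamma_half_add (ω : ℝ) :
    Complex.Gamma (1 / 2 - Complex.I * ω) * Complex.Gamma (1 / 2 + Complex.I * ω) =
      ((Real.pi / Real.cosh (Real.pi * ω) : ℝ) : ℂ) := by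
  have h := Complex.Gamma_mul_Gamma_one_sub (1 / 2 + Complex.I * ω)
  rw [show (1 : ℂ) - (1 / 2 + Complex.I * ω) = 1 / 2 - Complex.I * ω by ring,
    show (Real.pi * (1 / 2 + Complex.I * ω) : ℂ) = Real.pi * ω * Complex.I + Real.pi / 2 by ring,
    Complex.sin_add_pi_div_two, Complex.cos_mul_I] at h
  rw [mul_comm, h]
  push_cast
  rfl

theorem integral_exp_mul_f_exp_even (p : ℕ) (hp : 0 < p) {ω : ℝ} (hω : ω ≠ 0) :
    ∫ v : ℝ, Complex.exp (-(Complex.I * ω * v)) * (f (2 * p + 2) (Real.exp v) : ℂ) =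
      Complex.I * ((2 * Real.pi * (∏ j ∈ Finset.range p, ((j : ℝ) ^ 2 + ω ^ 2)) /
        ((2 * p).factorial * Real.sinh (Real.pi * ω)) : ℝ) : ℂ) := by
  have hω' : (ω : ℂ) ≠ 0 := by exact_mod_cast hω
  have h := Gamma_add_nat_mul_Gamma_add_nat 0 ω hω p
  simp only [Complex.ofReal_zero, zero_add, add_zero, zero_sub,
    Gamma_neg_I_mul_mul_Gamma_I_mul hω] at h
  rw [integral_exp_mul_f_exp (by omega), show ((2 * p : ℕ) : ℂ) / 2 = p by push_cast; ring, h]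
  push_cast
  field_simp

theorem integral_exp_mul_f_exp_odd (p : ℕ) {ω : ℝ} (hω : ω ≠ 0) :
    ∫ v : ℝ, Complex.exp (-(Complex.I * ω * v)) * (f (2 * p + 1 + 2) (Real.exp v) : ℂ) =
      Complex.I * ((2 * Real.pi * (ω * ∏ j ∈ Finset.range p, (((j : ℝ) + 1 / 2) ^ 2 + ω ^ 2)) /
        ((2 * p + 1).factorial * Real.cosh (Real.pi * ω)) : ℝ) : ℂ) := by
  have h := Gamma_add_nat_mul_Gamma_add_nat (1 / 2) ω hω p
  rw [show ((1 / 2 : ℝ) : ℂ) = 1 / 2 by push_cast; ring, Gamma_half_sub_mul_Gamma_half_add] at h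
  rw [integral_exp_mul_f_exp (by omega),
    show ((2 * p + 1 : ℕ) : ℂ) / 2 = 1 / 2 + p by push_cast; ring, h]
  push_cast
  field_simp

/-! ### Decay of `f` and Poisson summation -/

theorem abs_f_le {s : ℕ} (hs : 0 < s) {x : ℝ} (hx : 0 < x) :
    |f (s + 2) x| ≤ √x ∧ |f (s + 2) x| ≤ (√x)⁻¹ := by
  have h1 : 0 < √x := Real.sqrt_pos.2 hx
  have h2 : √x * √x = x := Real.mul_self_sqrt hx.le
  have hq0 : 0 ≤ √x / (1 + x) := by positivity
  have hq1 : √x / (1 + x) ≤ 1 := by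
    rw [div_le_one (by positivity)]; nlinarith [sq_nonneg (√x - 1)]
  have hb : |(1 - x) / (1 + x)| ≤ 1 := by
    rw [abs_div, abs_of_pos (by positivity : 0 < 1 + x), div_le_one (by positivity), abs_le]
    constructor <;> linarith
  have h : |f (s + 2) x| ≤ √x / (1 + x) := by
    rw [f, Nat.add_sub_cancel, abs_mul, abs_of_nonneg (pow_nonneg hq0 s)]
    calc _ ≤ (√x / (1 + x)) ^ s * 1 := by gcongr
      _ = (√x / (1 + x)) ^ s := mul_one _
      _ ≤ √x / (1 + x) := pow_le_of_le_one hq0 hq1 hs.ne'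
  refine ⟨h.trans (div_le_self h1.le (by linarith)), h.trans ?_⟩
  rw [div_le_iff₀ (by positivity), inv_mul_eq_div, le_div_iff₀ h1]
  linarith

theorem sqrt_pow_eq {y : ℝ} (hy : 0 ≤ y) (k : ℕ) : √(y ^ k) = √y ^ k := by
  rw [Real.sqrt_eq_iff_mul_self_eq (pow_nonneg hy k) (by positivity), ← mul_pow,
    Real.mul_self_sqrt hy]

theorem summable_f_two_pow_mul {s : ℕ} (hs : 0 < s) {x : ℝ} (hx : 0 < x) :
    Summable fun k : ℕ => f (s + 2) (2 ^ k * x) := by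
  refine Summable.of_norm_bounded (g := fun k : ℕ => (√2)⁻¹ ^ k * (√x)⁻¹) ?_ fun k => ?_
  · refine (summable_geometric_of_lt_one (by positivity) ?_).mul_right _
    exact inv_lt_one_of_one_lt₀ (Real.lt_sqrt_of_sq_lt (by norm_num))
  · refine (abs_f_le hs (by positivity)).2.trans (le_of_eq ?_)
    rw [Real.sqrt_mul (by positivity), mul_inv, inv_pow, sqrt_pow_eq two_pos.le]

theorem summable_f_half_pow_mul {s : ℕ} (hs : 0 < s) {x : ℝ} (hx : 0 < x) :
    Summable fun k : ℕ => f (s + 2) ((1 / 2) ^ k * x) := by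
  refine Summable.of_norm_bounded (g := fun k : ℕ => √(1 / 2) ^ k * √x) ?_ fun k => ?_
  · refine (summable_geometric_of_lt_one (by positivity) ?_).mul_right _
    rw [Real.sqrt_lt' one_pos]; norm_num
  · refine (abs_f_le hs (by positivity)).1.trans (le_of_eq ?_)
    rw [Real.sqrt_mul (by positivity), sqrt_pow_eq one_half_pos.le]

theorem continuous_f_exp (s : ℕ) : Continuous fun v : ℝ => f (s + 2) (Real.exp v) := by
  unfold f
  have : ∀ v : ℝ, 1 + Real.exp v ≠ 0 := fun v => by positivity
  fun_prop (disch := assumption)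

theorem isBigO_f_exp {s : ℕ} (hs : 0 < s) :
    (fun t : ℝ => (f (s + 2) (Real.exp (Real.log 2 * t)) : ℂ)) =O[Filter.cocompact ℝ]
      fun t : ℝ => |t| ^ (-2 : ℝ) := by
  have hL : 0 < Real.log 2 := Real.log_pos one_lt_two
  have key : ∀ v : ℝ, |f (s + 2) (Real.exp v)| ≤ Real.exp (-(|v| / 2)) := by
    intro v
    have hsq : √(Real.exp v) = Real.exp (v / 2) :=
      (Real.sqrt_eq_iff_mul_self_eq (Real.exp_pos v).le (Real.exp_pos (v / 2)).le).2
        (by rw [← Real.exp_add]; ring_nf)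
    obtain ⟨h1, h2⟩ := abs_f_le hs (Real.exp_pos v)
    rw [hsq] at h1 h2
    rw [← Real.exp_neg] at h2
    rcases abs_cases v with ⟨h, _⟩ | ⟨h, _⟩ <;> rw [h]
    · exact h2
    · convert h1 using 2; ring
  -- With `y = log 2 * |t| / 2`, the constant comes from `exp (-y) ≤ 2 / y ^ 2`.
  refine Asymptotics.IsBigO.of_bound (8 / Real.log 2 ^ 2) ?_
  have hne : ∀ᶠ t : ℝ in Filter.cocompact ℝ, t ≠ 0 := by
    have := (isCompact_singleton (x := (0 : ℝ))).compl_mem_cocompact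
    filter_upwards [this] with t ht using ht
  filter_upwards [hne] with t ht
  have hy : 0 < |t| := abs_pos.2 ht
  rw [Complex.norm_real, Real.norm_eq_abs, Real.norm_of_nonneg (by positivity),
    Real.rpow_neg hy.le, Real.rpow_two]
  refine (key _).trans ?_
  rw [Real.exp_neg, abs_mul, abs_of_pos hL, ← div_eq_mul_inv, div_div,
    inv_le_comm₀ (Real.exp_pos _) (by positivity), inv_div]
  have := Real.quadratic_le_exp_of_nonneg (x := Real.log 2 * |t| / 2) (by positivity)
  have h3 : 0 < Real.log 2 * |t| / 2 := by positivity
  nlinarith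

open FourierTransform in
theorem fourier_f_exp (n : ℕ) (w : ℝ) :
    𝓕 (fun t : ℝ => (f n (Real.exp (Real.log 2 * t)) : ℂ)) w =
      (Real.log 2 : ℂ)⁻¹ * ∫ v : ℝ,
        Complex.exp (-(Complex.I * ((2 * Real.pi * w / Real.log 2 : ℝ) : ℂ) * v)) *
          (f n (Real.exp v) : ℂ) := by
  have hL : 0 < Real.log 2 := Real.log_pos one_lt_two
  have hL' : ((Real.log 2 : ℝ) : ℂ) ≠ 0 := by exact_mod_cast hL.ne'
  have h := MeasureTheory.Measure.integral_comp_mul_left (fun v : ℝ =>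
    Complex.exp (-(Complex.I * ((2 * Real.pi * w / Real.log 2 : ℝ) : ℂ) * v)) *
        (f n (Real.exp v) : ℂ)) (Real.log 2)
  rw [abs_of_pos (inv_pos.2 hL), Complex.real_smul, Complex.ofReal_inv] at h
  rw [Real.fourier_real_eq_integral_exp_smul, ← h]
  refine MeasureTheory.integral_congr_ae (.of_forall fun t => ?_)
  simp only [smul_eq_mul]
  congr 2
  push_cast
  field_simp

-- Poisson summation at the point `logb 2 x`. The transform is odd in the frequency, so the zero
-- mode drops out and opposite modes pair into sines; `r k` belongs to frequency `k + 1`.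
open FourierTransform in
theorem tsum_two_sided_eq {s : ℕ} (hs : 0 < s) (r : ℕ → ℝ) (hr : Summable r)
    (hint : ∀ k : ℕ, ∫ v : ℝ, Complex.exp (-(Complex.I *
      ((2 * Real.pi * (k + 1) / Real.log 2 : ℝ) : ℂ) * v)) * (f (s + 2) (Real.exp v) : ℂ) =
      Complex.I * (r k : ℂ)) {x : ℝ} (hx : 0 < x) :
    ∑' k : ℕ, f (s + 2) (2 ^ (k + 1) * x) + ∑' k : ℕ, f (s + 2) ((1 / 2) ^ k * x) =
      -(2 / Real.log 2) * ∑' k : ℕ, r k * Real.sin (2 * (k + 1) * Real.pi * Real.logb 2 x) := by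
  have hL : 0 < Real.log 2 := Real.log_pos one_lt_two
  set φ : ℝ → ℂ := fun t => (f (s + 2) (Real.exp (Real.log 2 * t)) : ℂ) with hφ
  set t₀ := Real.logb 2 x with ht₀
  have hpos : ∀ k : ℕ, 𝓕 φ ((k + 1 : ℕ) : ℤ) = (Real.log 2 : ℂ)⁻¹ * (Complex.I * r k) := by
    intro k
    rw [fourier_f_exp, ← hint k]
    push_cast
    rfl
  have hneg : ∀ k : ℕ, 𝓕 φ (-(k + 1 : ℕ) : ℤ) = -((Real.log 2 : ℂ)⁻¹ * (Complex.I * r k)) := by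
    intro k
    rw [fourier_f_exp, ← hint k, integral_exp_mul_f_exp hs, integral_exp_mul_f_exp hs]
    push_cast
    rw [show (2 * Real.pi * -((k : ℂ) + 1) / (Real.log 2 : ℂ)) =
      -(2 * Real.pi * (k + 1) / (Real.log 2 : ℂ)) by ring, mul_neg (Complex.I), sub_neg_eq_add,
      ← sub_eq_add_neg]
    ring
  have hzero : 𝓕 φ ((0 : ℤ) : ℝ) = 0 := by
    rw [fourier_f_exp, integral_exp_mul_f_exp hs]
    simp
  have hrC : Summable fun k => (Real.log 2 : ℂ)⁻¹ * (Complex.I * (r k : ℂ)) :=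
    ((Complex.summable_ofReal.2 hr).mul_left _).mul_left _
  have hsum : Summable fun m : ℤ => 𝓕 φ m := by
    refine Summable.of_add_one_of_neg_add_one ?_ ?_
    · exact hrC.congr fun k => (hpos k).symm
    · refine hrC.neg.congr fun k => ?_
      rw [← hneg k]; push_cast; rfl
  have hexp : ∀ t : ℝ, Real.exp (Real.log 2 * (t₀ + t)) = 2 ^ t * x := by
    intro t
    rw [mul_add, Real.exp_add, ht₀, Real.logb, mul_div_cancel₀ _ hL.ne', Real.exp_log hx,
      Real.rpow_def_of_pos two_pos, mul_comm]
  have hp1 : ∀ k : ℕ, φ (t₀ + ((k + 1 : ℕ) : ℤ)) = (f (s + 2) (2 ^ (k + 1) * x) : ℂ) := by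
    intro k
    simp only [hφ, hexp]
    rw [Int.cast_natCast, Real.rpow_natCast]
  have hp2 : ∀ k : ℕ, φ (t₀ + ((-(k : ℤ) : ℤ) : ℝ)) = (f (s + 2) ((1 / 2) ^ k * x) : ℂ) := by
    intro k
    simp only [hφ, hexp]
    rw [Int.cast_neg, Int.cast_natCast, Real.rpow_neg two_pos.le, Real.rpow_natCast, one_div,
      inv_pow]
  have hS1 := (summable_nat_add_iff 1).2 (summable_f_two_pow_mul hs hx)
  have hS2 := summable_f_half_pow_mul hs hx
  have hS2' := (summable_nat_add_iff 1).2 hS2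
  have hP := Real.tsum_eq_tsum_fourier_of_rpow_decay_of_summable (f := φ)
    (Complex.continuous_ofReal.comp ((continuous_f_exp s).comp (by fun_prop)))
    one_lt_two (isBigO_f_exp hs) hsum t₀
  have hleft : ∑' m : ℤ, φ (t₀ + m) = ((∑' k : ℕ, f (s + 2) (2 ^ (k + 1) * x) +
      ∑' k : ℕ, f (s + 2) ((1 / 2) ^ k * x) : ℝ) : ℂ) := by
    -- The `k = 0` term of the halving sum is the index `0` of the sum over `ℤ`; it is split off so
    -- that the remaining indices are `±(k + 1)`.
    rw [hS2.tsum_eq_zero_add]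
    have h1 : HasSum (fun k : ℕ => φ (t₀ + (((k : ℤ) + 1 : ℤ) : ℝ)))
        ((∑' k : ℕ, f (s + 2) (2 ^ (k + 1) * x) : ℝ) : ℂ) :=
      (Complex.hasSum_ofReal.2 hS1.hasSum).congr_fun fun k => hp1 k
    have h2 : HasSum (fun k : ℕ => φ (t₀ + ((-((k : ℤ) + 1) : ℤ) : ℝ)))
        ((∑' k : ℕ, f (s + 2) ((1 / 2) ^ (k + 1) * x) : ℝ) : ℂ) :=
      (Complex.hasSum_ofReal.2 hS2'.hasSum).congr_fun fun k => hp2 (k + 1)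
    rw [(HasSum.of_add_one_of_neg_add_one (f := fun m : ℤ => φ (t₀ + m)) h1 h2).tsum_eq]
    have := hp2 0
    simp only [CharP.cast_eq_zero, neg_zero] at this
    rw [this]
    push_cast
    ring
  have hterm : ∀ k : ℕ,
      𝓕 φ (((k : ℤ) + 1 : ℤ) : ℝ) * fourier ((k : ℤ) + 1) (t₀ : UnitAddCircle) +
      𝓕 φ ((-((k : ℤ) + 1) : ℤ) : ℝ) * fourier (-((k : ℤ) + 1)) (t₀ : UnitAddCircle) =
      ((-(2 / Real.log 2) * (r k * Real.sin (2 * (k + 1) * Real.pi * t₀)) : ℝ) : ℂ) := by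
    intro k
    have e1 := hpos k
    have e2 := hneg k
    push_cast at e1 e2
    rw [fourier_coe_apply, fourier_coe_apply]
    push_cast
    rw [e1, e2, Complex.sin,
      show (2 * Real.pi * Complex.I * ((k : ℂ) + 1) * t₀ / 1) =
        2 * (k + 1) * Real.pi * t₀ * Complex.I by ring,
      show (2 * Real.pi * Complex.I * -((k : ℂ) + 1) * t₀ / 1) =
        -(2 * (k + 1) * Real.pi * t₀) * Complex.I by ring]
    ring
  have hright : ∑' m : ℤ, 𝓕 φ m * fourier m (t₀ : UnitAddCircle) =
      ((-(2 / Real.log 2) * ∑' k : ℕ, r k * Real.sin (2 * (k + 1) * Real.pi * t₀) : ℝ) : ℂ) := by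
    have hs1 : Summable fun m : ℤ => 𝓕 φ m * fourier m (t₀ : UnitAddCircle) := by
      refine Summable.of_norm_bounded hsum.norm fun m => ?_
      rw [norm_mul, fourier_apply, Circle.norm_coe, mul_one]
    have i1 : Function.Injective fun k : ℕ => (k : ℤ) + 1 := fun a b h => by simpa using h
    have i2 : Function.Injective fun k : ℕ => -((k : ℤ) + 1) := fun a b h => by simpa using h
    have g1 := hs1.comp_injective i1
    have g2 := hs1.comp_injective i2
    have hT := tsum_of_add_one_of_neg_add_one
      (f := fun m : ℤ => 𝓕 φ m * fourier m (t₀ : UnitAddCircle)) g1 g2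
    rw [hT, hzero, zero_mul, add_zero]
    refine (g1.tsum_add g2).symm.trans ?_
    rw [← tsum_mul_left, Complex.ofReal_tsum]
    exact tsum_congr hterm
  rw [hleft, hright] at hP
  exact_mod_cast hP

/-! ### Convergence of the sine series: polynomial numerators, exponential denominators -/

theorem prod_sq_add_sq_le (a β : ℝ) (p k : ℕ) (hk : 1 ≤ k) :
    ∏ j ∈ Finset.range p, (((j : ℝ) + a) ^ 2 + (β * k) ^ 2) ≤
      (∏ j ∈ Finset.range p, (((j : ℝ) + a) ^ 2 + β ^ 2)) * (k : ℝ) ^ (2 * p) := by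
  have hk' : (1 : ℝ) ≤ (k : ℝ) ^ 2 := one_le_pow₀ (by exact_mod_cast hk)
  have : (k : ℝ) ^ (2 * p) = ∏ _j ∈ Finset.range p, (k : ℝ) ^ 2 := by
    rw [Finset.prod_const, Finset.card_range, pow_mul]
  rw [this, ← Finset.prod_mul_distrib]
  refine Finset.prod_le_prod (fun j _ => by positivity) fun j _ => ?_
  nlinarith [sq_nonneg ((j : ℝ) + a)]

/-- `D k` is an exponentially growing denominator. -/
theorem summable_pow_mul_prod_div (a β : ℝ) (p q : ℕ) {α δ : ℝ} (hα : 0 < α) (hδ : 0 < δ)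
    (D : ℕ → ℝ) (hD : ∀ k : ℕ, 1 ≤ k → δ * Real.exp (α * k) ≤ D k) :
    Summable fun k : ℕ => ((k + 1 : ℕ) : ℝ) ^ q *
      (∏ j ∈ Finset.range p, (((j : ℝ) + a) ^ 2 + (β * (k + 1 : ℕ)) ^ 2)) / D (k + 1) := by
  set P := ∏ j ∈ Finset.range p, (((j : ℝ) + a) ^ 2 + β ^ 2)
  have h0 := ((Real.summable_pow_mul_exp_neg_nat_mul (q + 2 * p) hα).mul_left (P / δ))
  refine Summable.of_nonneg_of_le (fun k => ?_) (fun k => ?_) ((summable_nat_add_iff 1).2 h0)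
  · have := (by positivity : 0 < δ * Real.exp (α * (k + 1 : ℕ))).trans_le (hD (k + 1) (by omega))
    have h2 : 0 ≤ ∏ j ∈ Finset.range p, (((j : ℝ) + a) ^ 2 + (β * (k + 1 : ℕ)) ^ 2) :=
      Finset.prod_nonneg fun j _ => by positivity
    positivity
  · have h1 := prod_sq_add_sq_le a β p (k + 1) (by omega)
    have h2 : 0 ≤ ∏ j ∈ Finset.range p, (((j : ℝ) + a) ^ 2 + (β * (k + 1 : ℕ)) ^ 2) :=
      Finset.prod_nonneg fun j _ => by positivity
    calc _ ≤ ((k + 1 : ℕ) : ℝ) ^ q * (P * ((k + 1 : ℕ) : ℝ) ^ (2 * p)) /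
          (δ * Real.exp (α * (k + 1 : ℕ))) := by
          gcongr
          exact hD (k + 1) (by omega)
      _ = _ := by
          rw [show -α * ((k + 1 : ℕ) : ℝ) = -(α * (k + 1 : ℕ)) by ring, Real.exp_neg, pow_add]
          field_simp

theorem mul_exp_le_sinh {α : ℝ} (hα : 0 < α) (k : ℕ) (hk : 1 ≤ k) :
    (1 - Real.exp (-2 * α)) / 2 * Real.exp (α * k) ≤ Real.sinh (α * k) := by
  have hk' : (1 : ℝ) ≤ k := by exact_mod_cast hk
  have h : Real.exp (-(α * k)) ≤ Real.exp (-2 * α) * Real.exp (α * k) := by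
    rw [← Real.exp_add, Real.exp_le_exp]; nlinarith
  rw [Real.sinh_eq]
  linarith

theorem mul_exp_le_cosh (y : ℝ) : 1 / 2 * Real.exp y ≤ Real.cosh y := by
  rw [Real.cosh_eq]
  linarith [Real.exp_pos (-y)]

theorem summable_c_div_sinh (l : ℕ) :
    Summable fun k : ℕ =>
      c l (k + 1) / Real.sinh (2 * ((k + 1 : ℕ) : ℝ) * Real.pi ^ 2 / Real.log 2) := by
  have hL : 0 < Real.log 2 := Real.log_pos one_lt_two
  have hα : 0 < 2 * Real.pi ^ 2 / Real.log 2 := by positivity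
  have hδ : 0 < (1 - Real.exp (-2 * (2 * Real.pi ^ 2 / Real.log 2))) / 2 := by
    have : Real.exp (-2 * (2 * Real.pi ^ 2 / Real.log 2)) < 1 :=
      Real.exp_lt_one_iff.2 (by linarith)
    linarith
  have h := summable_pow_mul_prod_div 0 (2 * Real.pi / Real.log 2) (l - 1) 0 hα hδ
    (fun k => Real.sinh (2 * Real.pi ^ 2 / Real.log 2 * k)) (mul_exp_le_sinh hα)
  refine (h.mul_left ((2 * l - 2).factorial : ℝ)⁻¹).congr fun k => ?_
  rw [c, div_div, inv_mul_eq_div, div_div, mul_comm (Real.sinh _)]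
  congr 1
  · rw [pow_zero, one_mul]
    refine Finset.prod_congr rfl fun j _ => ?_
    ring
  · congr 2; ring

theorem summable_b_div_cosh (l : ℕ) :
    Summable fun k : ℕ =>
      b l (k + 1) / Real.cosh (2 * ((k + 1 : ℕ) : ℝ) * Real.pi ^ 2 / Real.log 2) := by
  have hL : 0 < Real.log 2 := Real.log_pos one_lt_two
  have hα : 0 < 2 * Real.pi ^ 2 / Real.log 2 := by positivity
  have h := summable_pow_mul_prod_div (1 / 2) (2 * Real.pi / Real.log 2) (l - 1) 1 hα one_half_pos
    (fun k => Real.cosh (2 * Real.pi ^ 2 / Real.log 2 * k)) (fun k _ => mul_exp_le_cosh _)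
  refine (h.mul_left (2 * Real.pi / (Real.log 2 * (2 * l - 1).factorial))).congr fun k => ?_
  have e1 : 2 * Real.pi ^ 2 / Real.log 2 * ((k + 1 : ℕ) : ℝ) =
    2 * ((k + 1 : ℕ) : ℝ) * Real.pi ^ 2 / Real.log 2 := by ring
  have e2 : ∏ j ∈ Finset.range (l - 1),
        (((j : ℝ) + 1 / 2) ^ 2 + 4 * Real.pi ^ 2 * ((k + 1 : ℕ) : ℝ) ^ 2 / Real.log 2 ^ 2) =
      ∏ j ∈ Finset.range (l - 1),
        (((j : ℝ) + 1 / 2) ^ 2 + (2 * Real.pi / Real.log 2 * ((k + 1 : ℕ) : ℝ)) ^ 2) :=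
    Finset.prod_congr rfl fun j _ => by ring
  rw [b, e2, e1]
  field_simp

theorem summable_mul_sin_div {u D : ℕ → ℝ} (h : Summable fun k => u k / D k) (θ : ℕ → ℝ) :
    Summable fun k => u k * (Real.sin (θ k) / D k) := by
  refine Summable.of_norm_bounded h.norm fun k => ?_
  rw [mul_div_left_comm, mul_comm, norm_mul]
  exact mul_le_of_le_one_right (norm_nonneg _) (Real.abs_sin_le_one _)

/-! ### Power series for the halving sum -/

/-- Taylor coefficients of `(1 - x) / (1 + x) ^ (s + 1)` at `0`. -/
noncomputable def taylorCoeff (s m : ℕ) : ℝ :=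
  (-1) ^ m * (2 * (m + s).choose s - (m + (s - 1)).choose (s - 1))

theorem hasSum_taylorCoeff {s : ℕ} (hs : 0 < s) {x : ℝ} (hx : |x| < 1) :
    HasSum (fun m => taylorCoeff s m * x ^ m) ((1 - x) / (1 + x) ^ (s + 1)) := by
  have hx' : ‖-x‖ < 1 := by rwa [norm_neg]
  have h0 : 1 + x ≠ 0 := by linarith [(abs_lt.1 hx).1]
  have h1 := (hasSum_choose_mul_geometric_of_norm_lt_one s hx').mul_left 2
  have h2 := hasSum_choose_mul_geometric_of_norm_lt_one (s - 1) hx'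
  rw [Nat.sub_add_cancel hs] at h2
  -- Writing `1 - x = 2 - (1 + x)` reduces the expansion to two negative binomial series.
  have e : (1 - x) / (1 + x) ^ (s + 1) =
      2 * (1 / (1 - -x) ^ (s + 1)) - 1 / (1 - -x) ^ s := by
    rw [sub_neg_eq_add, pow_succ]
    field_simp
    ring
  rw [e]
  refine (h1.sub h2).congr_fun fun m => ?_
  rw [taylorCoeff, neg_pow x]
  ring

/-- Coefficients of the power series of `∑ k, f (s + 2) (x / 2 ^ k)` divided by `√x ^ s`. -/
noncomputable def dyadicCoeff (s m : ℕ) : ℝ :=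
  taylorCoeff s m / (1 - √(1 / 2) ^ (2 * m + s))

theorem sqrt_half_pos_lt_one : 0 < √(1 / 2 : ℝ) ∧ √(1 / 2 : ℝ) < 1 := by
  refine ⟨by positivity, ?_⟩
  rw [Real.sqrt_lt' one_pos]; norm_num

theorem hasSum_f_half_pow_mul {s : ℕ} (hs : 0 < s) {x : ℝ} (hx0 : 0 < x) (hx1 : x < 1) (k : ℕ) :
    HasSum (fun m => √x ^ s * (taylorCoeff s m * x ^ m) * (√(1 / 2) ^ (2 * m + s)) ^ k)
      (f (s + 2) ((1 / 2) ^ k * x)) := by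
  have hr : √(1 / 2 : ℝ) ^ 2 = 1 / 2 := Real.sq_sqrt (by norm_num)
  have hy : (1 / 2 : ℝ) ^ k * x ≤ x :=
    mul_le_of_le_one_left hx0.le (pow_le_one₀ (by norm_num) (by norm_num))
  have hy0 : 0 < (1 / 2 : ℝ) ^ k * x := by positivity
  have h := (hasSum_taylorCoeff hs (x := (1 / 2) ^ k * x)
    (by rw [abs_of_pos hy0]; linarith)).mul_left (√((1 / 2) ^ k * x) ^ s)
  have hsq : √((1 / 2 : ℝ) ^ k * x) = √(1 / 2) ^ k * √x := by
    rw [Real.sqrt_mul (by positivity), sqrt_pow_eq one_half_pos.le]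
  have e : f (s + 2) ((1 / 2) ^ k * x) = √((1 / 2) ^ k * x) ^ s *
      ((1 - (1 / 2) ^ k * x) / (1 + (1 / 2) ^ k * x) ^ (s + 1)) := by
    rw [f, Nat.add_sub_cancel, div_pow, pow_succ, div_mul_div_comm, mul_div_assoc]
  rw [e]
  refine h.congr_fun fun m => ?_
  have hk : (1 / 2 : ℝ) ^ k = (√(1 / 2) ^ k) ^ 2 := by rw [← pow_mul, mul_comm, pow_mul, hr]
  rw [hsq, hk]
  ring

/-- As `s > 0`, the ratio `√(1 / 2) ^ (2 * m + s)` is at most `√(1 / 2)`, so the denominators stay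
away from `0` uniformly in `m` and convergence is inherited from the Taylor series. -/
theorem abs_dyadicCoeff_le {s : ℕ} (hs : 0 < s) (m : ℕ) :
    |dyadicCoeff s m| ≤ |taylorCoeff s m| / (1 - √(1 / 2)) := by
  obtain ⟨h0, h1⟩ := sqrt_half_pos_lt_one
  have h2 : √(1 / 2 : ℝ) ^ (2 * m + s) ≤ √(1 / 2) := pow_le_of_le_one h0.le h1.le (by omega)
  rw [dyadicCoeff, abs_div, abs_of_pos (by linarith : 0 < 1 - √(1 / 2 : ℝ) ^ (2 * m + s))]
  exact div_le_div_of_nonneg_left (abs_nonneg _) (by linarith) (by linarith)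

theorem summable_dyadicCoeff_mul_pow {s : ℕ} (hs : 0 < s) {x : ℝ} (hx0 : 0 ≤ x) (hx1 : x < 1) :
    Summable fun m => dyadicCoeff s m * x ^ m := by
  have h := (hasSum_taylorCoeff hs (x := x) (by rwa [abs_of_nonneg hx0])).summable.norm.mul_left
    (1 - √(1 / 2))⁻¹
  refine Summable.of_norm_bounded h fun m => ?_
  rw [norm_mul, norm_mul, ← mul_assoc, inv_mul_eq_div]
  exact mul_le_mul_of_nonneg_right (abs_dyadicCoeff_le hs m) (norm_nonneg _)

theorem tsum_f_half_pow_mul {s : ℕ} (hs : 0 < s) {x : ℝ} (hx0 : 0 < x) (hx1 : x < 1) :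
    ∑' k : ℕ, f (s + 2) ((1 / 2) ^ k * x) = √x ^ s * ∑' m : ℕ, dyadicCoeff s m * x ^ m := by
  obtain ⟨h0, h1⟩ := sqrt_half_pos_lt_one
  have hT := (hasSum_taylorCoeff hs (x := x) (by rwa [abs_of_pos hx0])).summable.mul_left (√x ^ s)
  have hG := summable_geometric_of_lt_one h0.le h1
  -- Absolute convergence of the double series, needed to interchange the sums: it is dominated by
  -- the Taylor series times the geometric series of ratio `√(1 / 2)`.
  have hprod : Summable (Function.uncurry fun m k : ℕ =>
      √x ^ s * (taylorCoeff s m * x ^ m) * (√(1 / 2) ^ (2 * m + s)) ^ k) := by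
    refine Summable.of_norm_bounded (hT.norm.mul_of_nonneg hG (fun _ => norm_nonneg _)
      fun _ => pow_nonneg h0.le _) fun ⟨m, k⟩ => ?_
    simp only [Function.uncurry_apply_pair]
    rw [norm_mul]
    refine mul_le_mul_of_nonneg_left ?_ (norm_nonneg _)
    rw [Real.norm_of_nonneg (by positivity)]
    exact pow_le_pow_left₀ (by positivity) (pow_le_of_le_one h0.le h1.le (by omega)) k
  calc _ = ∑' (k : ℕ) (m : ℕ),
        √x ^ s * (taylorCoeff s m * x ^ m) * (√(1 / 2) ^ (2 * m + s)) ^ k :=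
        tsum_congr fun k => (hasSum_f_half_pow_mul hs hx0 hx1 k).tsum_eq.symm
    _ = ∑' (m : ℕ) (k : ℕ),
        √x ^ s * (taylorCoeff s m * x ^ m) * (√(1 / 2) ^ (2 * m + s)) ^ k := hprod.tsum_comm
    _ = ∑' m : ℕ, √x ^ s * (dyadicCoeff s m * x ^ m) := by
        refine tsum_congr fun m => ?_
        rw [tsum_mul_left, tsum_geometric_of_lt_one (by positivity)
          (pow_lt_one₀ h0.le h1 (by omega)), dyadicCoeff]
        ring
    _ = _ := tsum_mul_left

/-! ### Assembly of the even and odd cases -/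

theorem hasSum_shift {u : ℕ → ℝ} {x S : ℝ} (d : ℕ) (h : HasSum (fun m => u m * x ^ m) S) :
    HasSum (fun m => (if d ≤ m then u (m - d) else 0) * x ^ m) (x ^ d * S) := by
  refine ((add_left_injective d).hasSum_iff fun m hm => ?_).1 ?_
  · rw [if_neg, zero_mul]
    intro hd
    exact hm ⟨m - d, Nat.sub_add_cancel hd⟩
  · refine (h.mul_left (x ^ d)).congr_fun fun m => ?_
    simp only [Function.comp_apply, Nat.le_add_left, if_true, Nat.add_sub_cancel, pow_add]
    ring

theorem summable_evenTerm (l : ℕ) (x : ℝ) : Summable fun k : ℕ => evenTerm l (k + 1) x :=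
  summable_mul_sin_div (summable_c_div_sinh l) _

theorem summable_oddTerm (l : ℕ) (x : ℝ) : Summable fun k : ℕ => oddTerm l (k + 1) x :=
  summable_mul_sin_div (summable_b_div_cosh l) _

theorem tsum_two_sided_even {p : ℕ} (hp : 0 < p) {x : ℝ} (hx : 0 < x) :
    F (2 * p + 2) x + ∑' k : ℕ, f (2 * p + 2) ((1 / 2) ^ k * x) =
      -(4 * Real.pi / Real.log 2 * ∑' k : ℕ, evenTerm (p + 1) (k + 1) x) := by
  have hL : 0 < Real.log 2 := Real.log_pos one_lt_two
  -- The sequence `r` is left as `_` and read off from the summability argument: `2π` times `c /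
  -- sinh`.
  have h := tsum_two_sided_eq (s := 2 * p) (by omega) _
    ((summable_c_div_sinh (p + 1)).mul_left (2 * Real.pi)) (fun k => ?_) hx
  · rw [F, h, ← tsum_mul_left, ← tsum_mul_left, ← tsum_neg]
    refine tsum_congr fun k => ?_
    rw [evenTerm]
    push_cast
    ring
  · rw [integral_exp_mul_f_exp_even p hp (by positivity), c, Nat.add_sub_cancel,
      show 2 * (p + 1) - 2 = 2 * p by omega]
    congr 2
    rw [mul_div_assoc, div_div]
    congr 2
    · refine Finset.prod_congr rfl fun j _ => ?_
      push_cast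
      ring
    · congr 2
      push_cast
      ring

theorem tsum_two_sided_odd (p : ℕ) {x : ℝ} (hx : 0 < x) :
    F (2 * p + 1 + 2) x + ∑' k : ℕ, f (2 * p + 1 + 2) ((1 / 2) ^ k * x) =
      -(4 * Real.pi / Real.log 2 * ∑' k : ℕ, oddTerm (p + 1) (k + 1) x) := by
  have hL : 0 < Real.log 2 := Real.log_pos one_lt_two
  have h := tsum_two_sided_eq (s := 2 * p + 1) (by omega) _
    ((summable_b_div_cosh (p + 1)).mul_left (2 * Real.pi)) (fun k => ?_) hx
  · rw [F, h, ← tsum_mul_left, ← tsum_mul_left, ← tsum_neg]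
    refine tsum_congr fun k => ?_
    rw [oddTerm]
    push_cast
    ring
  · rw [integral_exp_mul_f_exp_odd p (by positivity), b, Nat.add_sub_cancel,
      show 2 * (p + 1) - 1 = 2 * p + 1 by omega]
    have e1 : ∏ j ∈ Finset.range p, (((j : ℝ) + 1 / 2) ^ 2 +
          4 * Real.pi ^ 2 * ((k + 1 : ℕ) : ℝ) ^ 2 / Real.log 2 ^ 2) =
        ∏ j ∈ Finset.range p, (((j : ℝ) + 1 / 2) ^ 2 +
          (2 * Real.pi * (k + 1) / Real.log 2) ^ 2) :=
      Finset.prod_congr rfl fun j _ => by push_cast; ring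
    have e2 : 2 * ((k + 1 : ℕ) : ℝ) * Real.pi ^ 2 / Real.log 2 =
        Real.pi * (2 * Real.pi * (k + 1) / Real.log 2) := by push_cast; ring
    rw [e1, e2]
    congr 2
    push_cast
    field_simp

end AlmostIdentity

theorem mainTheorem4 (n : ℕ) (hn : 2 < n) :
    (∀ x : ℝ, 0 < x → Summable (fun k : ℕ => AlmostIdentity.f n (2 ^ (k + 1) * x))) ∧
    ∃ a : ℕ → ℝ,
      (n ≠ 3 → a 0 = 0) ∧
      (∀ x : ℝ, 0 ≤ x → x < 1 → Summable (fun m : ℕ => a m * x ^ m)) ∧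
      (∀ l : ℕ, n = 2 * l → ∀ x : ℝ, 0 < x → x < 1 →
        Summable (fun k : ℕ => AlmostIdentity.evenTerm l (k + 1) x) ∧
        AlmostIdentity.F n x =
          (∑' m : ℕ, a m * x ^ m) -
            4 * Real.pi / Real.log 2 * ∑' k : ℕ, AlmostIdentity.evenTerm l (k + 1) x) ∧
      (∀ l : ℕ, n = 2 * l + 1 → ∀ x : ℝ, 0 < x → x < 1 →
        Summable (fun k : ℕ => AlmostIdentity.oddTerm l (k + 1) x) ∧
        AlmostIdentity.F n x =
          Real.sqrt x * (∑' m : ℕ, a m * x ^ m) -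
            4 * Real.pi / Real.log 2 * ∑' k : ℕ, AlmostIdentity.oddTerm l (k + 1) x) := by
  open AlmostIdentity in
  obtain ⟨s, rfl⟩ : ∃ s, n = s + 2 := ⟨n - 2, by omega⟩
  have hs : 0 < s := by omega
  -- The factor `√x ^ s` is `x ^ (s / 2)`, times a further `√x` when `s` is odd; the integral power
  -- is absorbed into the coefficients as a shift.
  have hS : ∀ x : ℝ, 0 ≤ x → x < 1 →
      HasSum (fun m => (if s / 2 ≤ m then -dyadicCoeff s (m - s / 2) else 0) * x ^ m)
        (x ^ (s / 2) * -∑' m : ℕ, dyadicCoeff s m * x ^ m) := fun x hx0 hx1 =>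
    hasSum_shift (u := fun m => -dyadicCoeff s m) (s / 2)
      ((summable_dyadicCoeff_mul_pow hs hx0 hx1).hasSum.neg.congr_fun fun m => neg_mul _ _)
  refine ⟨fun x hx => (summable_nat_add_iff 1).2 (summable_f_two_pow_mul hs hx),
    fun m => if s / 2 ≤ m then -dyadicCoeff s (m - s / 2) else 0, fun h3 => ?_,
    fun x hx0 hx1 => (hS x hx0 hx1).summable, fun l hl x hx0 hx1 => ?_,
    fun l hl x hx0 hx1 => ?_⟩
  -- The shift `s / 2` vanishes only for `s = 1`, that is `n = 3`.
  · exact if_neg (by omega)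
  · refine ⟨summable_evenTerm l x, ?_⟩
    obtain ⟨p, rfl⟩ : ∃ p, l = p + 1 := ⟨l - 1, by omega⟩
    obtain rfl : s = 2 * p := by omega
    have h := tsum_two_sided_even (p := p) (by omega) hx0
    rw [tsum_f_half_pow_mul hs hx0 hx1, pow_mul, Real.sq_sqrt hx0.le] at h
    rw [(hS x hx0.le hx1).tsum_eq, Nat.mul_div_cancel_left p two_pos]
    linarith
  · refine ⟨summable_oddTerm l x, ?_⟩
    obtain ⟨p, rfl⟩ : ∃ p, l = p + 1 := ⟨l - 1, by omega⟩
    obtain rfl : s = 2 * p + 1 := by omega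
    have h := tsum_two_sided_odd p hx0
    rw [tsum_f_half_pow_mul hs hx0 hx1, pow_succ, pow_mul, Real.sq_sqrt hx0.le] at h
    rw [(hS x hx0.le hx1).tsum_eq, show (2 * p + 1) / 2 = p by omega]
    linarith
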